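/- **Proposition.** Let $G$ and $H$ be groups and let $f,g\colon G\to H$ be group homomorphisms. Then $f=g$ if and only if the topological spaces $X_f$ and $X_g$ are homeomorphic, where the spaces $X_f$ are defined as follows (the choices below depend only on $G$ and $H$, they are arbitrary, and the same choices are used for $X_f$ and $X_g$). *Choices.* Let $S'_G$ be a generating set of $G$ that does not contain the identity, with a well-order such that, if $\max S'_G$ exists and $|S'_G|>1$, then $\max S'_G$ has an immediate predecessor in $S'_G$. Put $S_G=\{-1,0\}\sqcup S'_G$, well-ordered by $-1<0<\alpha$ for all $\alpha\in S'_G$ and by the order of $S'_G$. Choose $S'_H$ and define $S_H$ likewise for $H$. For each $h\in H$ let $W_h$ be a non-empty well-ordered set with minimum $w_h$, such that $W_h\cong W_t$ as ordered sets if and only if $h=t$. Write $M_H=\{\beta\in S_H : \beta\ge 0 \text{ and } \beta \text{ is not the maximum of } S_H\}$. *The poset $X_H^G$.* Its points are: one point $*$; the points $(g,\alpha)$ with $g\in G$, $\alpha\in S_G$; the points $(h,\beta)$ with $h\in H$, $\beta\in S_H$; ten points $A_{(h,\beta)},B_{(h,\beta)},\dots,J_{(h,\beta)}$ for each $h\in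 H$, $\beta\in M_H$; and the elements of the sets $W_h$, $h\in H$; all these are distinct. Its partial order is the reflexive and transitive closure of the following relations. 1. $(g,\alpha)<(g,\delta)$ for $g\in G$ and $\alpha<\delta$ in $S_G$; $(g\alpha,-1)<(g,\alpha)$ for $g\in G$, $\alpha\in S'_G$; $*<(g,-1)$ for $g\in G$. 2. $(h,\beta)<(h,\gamma)$ for $h\in H$ and $\beta<\gamma$ in $S_H$; $(h\beta,-1)<(h,\beta)$ for $h\in H$, $\beta\in S'_H$; $(h,-1)<*$ for $h\in H$. 3. For $h\in H$ and $\beta\in M_H$ (with the index $(h,\beta)$ of the letters omitted): $C<A$, $D<A$, $(h,\beta)<B$, $C<B$, $D<(h,\beta)$, $(h,\beta)<E$, $I<E$, $H<F$, $J<F$, $I<G$, $J<G$, $H<(h,\beta)$. 4. The order of each $W_h$; and $A_{(h,0)}<w_h$ for each $h\in H$ (if $0\in M_H$). Let $X_*^G=\{*\}\cup (G\times S_G)$ and $X_H^*=X_H^G\setminus (G\times S_G)$, with the induced orders. *The space $X_f$.* If $G$ and $H$ are both non-trivial, $X_f$ is the set $X_H^G\setminus\bigcup_{h\in H}W_h$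 with the partial order generated (by transitivity) by the order induced from $X_H^G$ and the additional relations $$ (g,0)<A_{(f(g),0)}\quad (g\in G),\qquad *<A_{(h,0)}\quad (h\in H\setminus f(G)).$$ If $H$ is trivial, $X_f=X_*^G$; if $G$ is trivial and $H$ is not, $X_f=X_H^*$. In all cases $X_f$ carries the $T_0$ Alexandroff topology of its partial order, whose open sets are the lower sets. -/

import Mathlib

universe u v w

namespace Realization

/-- A set `S'` of non-trivial generators of the group `G` together with a well-order on it such
that, if `S'` has a maximum and more than one element, this maximum has an immediate predecessor. -/
structure GenSet (G : Type u) [Group G] where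
  S : Set G
  closure_eq_top : Subgroup.closure S = ⊤
  one_notMem : (1 : G) ∉ S
  linearOrder : LinearOrder S
  wellFoundedLT : WellFoundedLT S
  exists_covBy_max : ∀ m : S, IsTop m → S.Nontrivial → ∃ a : S, a ⋖ m

instance {G : Type u} [Group G] (D : GenSet G) : LinearOrder D.S := D.linearOrder

instance {G : Type u} [Group G] (D : GenSet G) : WellFoundedLT D.S := D.wellFoundedLT

namespace GenSet

variable {G : Type u} [Group G]

/-- The well-ordered set `S' ∪ {0, -1}`, where `-1 < 0 < α` for all `α ∈ S'`. -/
abbrev Idx (D : GenSet G) : Type u := WithBot (WithBot D.S)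

/-- The element `-1` of `S' ∪ {0, -1}`. -/
def negOne (D : GenSet G) : D.Idx := ⊥

/-- The element `0` of `S' ∪ {0, -1}`. -/
def zero (D : GenSet G) : D.Idx := ((⊥ : WithBot D.S) : WithBot (WithBot D.S))

/-- The inclusion of `S'` into `S' ∪ {0, -1}`. -/
def gen (D : GenSet G) (a : D.S) : D.Idx := ((a : WithBot D.S) : WithBot (WithBot D.S))

/-- The indices `β` with `0 ≤ β < max (S' ∪ {0, -1})`; when there is no maximum, the second
condition is void. -/
abbrev MidIdx (D : GenSet G) : Type u := {β : D.Idx // D.zero ≤ β ∧ ¬ IsMax β}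

lemma gen_lt_gen (D : GenSet G) {a b : D.S} : D.gen a < D.gen b ↔ a < b := by
  simp [gen]

lemma negOne_lt_zero (D : GenSet G) : D.negOne < D.zero := WithBot.bot_lt_coe _

lemma zero_lt_gen (D : GenSet G) (a : D.S) : D.zero < D.gen a := by
  simp [zero, gen]

end GenSet

/-- The names of the ten points of `S_(h,β) ∪ T_(h,β)`. -/
inductive Letter
  | A | B | C | D | E | F | G | H | I | J

section Construction

variable {G : Type u} {H : Type v} [Group G] [Group H]

/-- The points of `X_H^G`: the point `*`, the points `(g, α)` of `X_*^G`, and the points `(h, β)`,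
`A_(h,β)`, …, `J_(h,β)` and the elements of `W_h` of `X_H^*`. -/
inductive XHG (DG : GenSet G) (DH : GenSet H) (W : H → Type w) : Type (max u v w)
  | star : XHG DG DH W
  | ptG (g : G) (α : DG.Idx) : XHG DG DH W
  | ptH (h : H) (β : DH.Idx) : XHG DG DH W
  | aux (l : Letter) (h : H) (β : DH.MidIdx) : XHG DG DH W
  | ptW (h : H) (x : W h) : XHG DG DH W

namespace XHG

variable {DG : GenSet G} {DH : GenSet H} {W : H → Type w} [∀ h, LinearOrder (W h)]

/-- The listed relations `x < y` of `X_H^G`, which generate its order by transitivity. -/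
inductive Basic : XHG DG DH W → XHG DG DH W → Prop
  -- relations of `X_*^G`
  | colG (g : G) {α δ : DG.Idx} (hαδ : α < δ) : Basic (ptG g α) (ptG g δ)
  | genG (g : G) (a : DG.S) : Basic (ptG (g * a) DG.negOne) (ptG g (DG.gen a))
  | starG (g : G) : Basic star (ptG g DG.negOne)
  -- relations of `X_H^*`
  | colH (h : H) {β γ : DH.Idx} (hβγ : β < γ) : Basic (ptH h β) (ptH h γ)
  | genH (h : H) (b : DH.S) : Basic (ptH (h * b) DH.negOne) (ptH h (DH.gen b))
  | CA (h : H) (β : DH.MidIdx) : Basic (aux .C h β) (aux .A h β)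
  | DA (h : H) (β : DH.MidIdx) : Basic (aux .D h β) (aux .A h β)
  | hB (h : H) (β : DH.MidIdx) : Basic (ptH h β.1) (aux .B h β)
  | CB (h : H) (β : DH.MidIdx) : Basic (aux .C h β) (aux .B h β)
  | Dh (h : H) (β : DH.MidIdx) : Basic (aux .D h β) (ptH h β.1)
  | hE (h : H) (β : DH.MidIdx) : Basic (ptH h β.1) (aux .E h β)
  | IE (h : H) (β : DH.MidIdx) : Basic (aux .I h β) (aux .E h β)
  | HF (h : H) (β : DH.MidIdx) : Basic (aux .H h β) (aux .F h β)
  | JF (h : H) (β : DH.MidIdx) : Basic (aux .J h β) (aux .F h β)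
  | IG (h : H) (β : DH.MidIdx) : Basic (aux .I h β) (aux .G h β)
  | JG (h : H) (β : DH.MidIdx) : Basic (aux .J h β) (aux .G h β)
  | Hh (h : H) (β : DH.MidIdx) : Basic (aux .H h β) (ptH h β.1)
  | hstar (h : H) : Basic (ptH h DH.negOne) star
  | wellW (h : H) {x y : W h} (hxy : x < y) : Basic (ptW h x) (ptW h y)
  | AW (h : H) (β : DH.MidIdx) (hβ : β.1 = DH.zero) (x : W h) (hx : IsBot x) :
      Basic (aux .A h β) (ptW h x)

/-- The relations `x < y` that are added to those of `X_H^G` in order to obtain `X_f`. -/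
inductive New (f : G →* H) : XHG DG DH W → XHG DG DH W → Prop
  | fiber (g : G) (β : DH.MidIdx) (hβ : β.1 = DH.zero) :
      New f (ptG g DG.zero) (aux .A (f g) β)
  | notRange (h : H) (hh : h ∉ Set.range f) (β : DH.MidIdx) (hβ : β.1 = DH.zero) :
      New f star (aux .A h β)

/-- Auxiliary: a rank that shows that the generated relations are antisymmetric. -/
def level : XHG DG DH W → ℕ
  | star => 2
  | ptG _ _ => 3
  | ptH _ _ => 1
  | aux .A _ _ => 4
  | aux .B _ _ => 4
  | aux .E _ _ => 4
  | aux .F _ _ => 4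
  | aux .G _ _ => 4
  | aux _ _ _ => 0
  | ptW _ _ => 5

/-- Auxiliary: a strict order that contains all the generating relations. -/
inductive Below : XHG DG DH W → XHG DG DH W → Prop
  | lvl {p q : XHG DG DH W} (hpq : p.level < q.level) : Below p q
  | colG (g g' : G) {α δ : DG.Idx} (hαδ : α < δ) : Below (ptG g α) (ptG g' δ)
  | colH (h h' : H) {β γ : DH.Idx} (hβγ : β < γ) : Below (ptH h β) (ptH h' γ)
  | wellW (h : H) {x y : W h} (hxy : x < y) : Below (ptW h x) (ptW h y)

lemma Below.irrefl (p : XHG DG DH W) : ¬ Below p p := by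
  intro h
  cases h with
  | lvl h => exact lt_irrefl _ h
  | colG _ _ h => exact lt_irrefl _ h
  | colH _ _ h => exact lt_irrefl _ h
  | wellW _ h => exact lt_irrefl _ h

lemma Below.level_le {p q : XHG DG DH W} (h : Below p q) : p.level ≤ q.level := by
  cases h with
  | lvl h => exact h.le
  | colG _ _ h => exact le_rfl
  | colH _ _ h => exact le_rfl
  | wellW _ h => exact le_rfl

lemma Below.trans {p q r : XHG DG DH W} (h : Below p q) (h' : Below q r) : Below p r := by
  by_cases hl : p.level < r.level
  · exact .lvl hl
  · have h1 := h.level_le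
    have h2 := h'.level_le
    cases h with
    | lvl h => omega
    | colG _ _ h =>
      cases h' with
      | lvl h' => omega
      | colG _ _ h' => exact .colG _ _ (h.trans h')
    | colH _ _ h =>
      cases h' with
      | lvl h' => omega
      | colH _ _ h' => exact .colH _ _ (h.trans h')
    | wellW _ h =>
      cases h' with
      | lvl h' => omega
      | wellW _ h' => exact .wellW _ (h.trans h')

lemma Basic.below {p q : XHG DG DH W} (h : Basic p q) : Below p q := by
  cases h with
  | colG g h => exact .colG _ _ h
  | genG g a => exact .colG _ _ (DG.negOne_lt_zero.trans (DG.zero_lt_gen a))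
  | colH g h => exact .colH _ _ h
  | genH g a => exact .colH _ _ (DH.negOne_lt_zero.trans (DH.zero_lt_gen a))
  | wellW h hxy => exact .wellW _ hxy
  | _ => exact .lvl (by simp [level])

lemma New.below {f : G →* H} {p q : XHG DG DH W} (h : New f p q) : Below p q := by
  cases h <;> exact .lvl (by simp [level])

lemma eq_or_below_of_le {p q : XHG DG DH W} (h : Relation.ReflTransGen Basic p q) :
    p = q ∨ Below p q := by
  induction h with
  | refl => exact .inl rfl
  | tail _ hbc ih =>
    rcases ih with rfl | ih
    · exact .inr hbc.below
    · exact .inr (ih.trans hbc.below)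

/-- The order of `X_H^G`: the reflexive and transitive closure of the listed relations. -/
instance : PartialOrder (XHG DG DH W) where
  le := Relation.ReflTransGen Basic
  le_refl _ := .refl
  le_trans _ _ _ := .trans
  le_antisymm p q hpq hqp := by
    rcases eq_or_below_of_le hpq with h | h
    · exact h
    rcases eq_or_below_of_le hqp with h' | h'
    · exact h'.symm
    · exact (Below.irrefl _ (h.trans h')).elim

variable (DG DH W)

/-- The subset `X_*^G` of `X_H^G`. -/
def partG : Set (XHG DG DH W) := {p | p = star ∨ ∃ g α, p = ptG g α}

/-- The subset `X_H^*` of `X_H^G` (with the well-ordered sets `W_h`). -/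
def partH : Set (XHG DG DH W) := {p | ∀ g α, p ≠ ptG g α}

/-- The complement in `X_H^G` of the union of the sets `W_h`. -/
def withoutW : Set (XHG DG DH W) := {p | ∀ h x, p ≠ ptW h x}

open Classical in
/-- The underlying set of `X_f`, as a subset of `X_H^G`: `X_*^G` if `H` is trivial, `X_H^*` if `H`
is not trivial and `G` is trivial, and `X_H^G` without the sets `W_h` if neither is trivial. -/
noncomputable def carrier : Set (XHG DG DH W) :=
  if Subsingleton H then partG DG DH W
  else if Subsingleton G then partH DG DH W
  else withoutW DG DH W

end XHG

/-- The space `X_f`. -/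
def Xf (DG : GenSet G) (DH : GenSet H) (W : H → Type w) (_f : G →* H) : Type (max u v w) :=
  {p : XHG DG DH W // p ∈ XHG.carrier DG DH W}

namespace Xf

variable {DG : GenSet G} {DH : GenSet H} {W : H → Type w} [∀ h, LinearOrder (W h)]

/-- The generating relations of `X_f`: those of `X_H^G` and, if neither `G` nor `H` is trivial,
the additional relations determined by `f`. -/
def Basic {f : G →* H} (p q : Xf DG DH W f) : Prop :=
  p.1 ≤ q.1 ∨ (Nontrivial G ∧ Nontrivial H ∧ XHG.New f p.1 q.1)

lemma eq_or_below_of_le {f : G →* H} {p q : Xf DG DH W f} (h : Relation.ReflTransGen Basic p q) :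
    p = q ∨ XHG.Below p.1 q.1 := by
  induction h with
  | refl => exact .inl rfl
  | @tail b c _ hbc ih =>
    have key : b = c ∨ XHG.Below b.1 c.1 := by
      rcases hbc with hbc | ⟨_, _, hbc⟩
      · exact (XHG.eq_or_below_of_le hbc).imp (fun h => Subtype.ext h) id
      · exact .inr hbc.below
    rcases ih with rfl | ih
    · exact key
    · rcases key with rfl | key
      · exact .inr ih
      · exact .inr (ih.trans key)

/-- The order of `X_f`: the reflexive and transitive closure of the generating relations. -/
instance (f : G →* H) : PartialOrder (Xf DG DH W f) where
  le := Relation.ReflTransGen Basic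
  le_refl _ := .refl
  le_trans _ _ _ := .trans
  le_antisymm p q hpq hqp := by
    rcases eq_or_below_of_le hpq with h | h
    · exact h
    rcases eq_or_below_of_le hqp with h' | h'
    · exact h'.symm
    · exact (XHG.Below.irrefl _ (h.trans h')).elim

/-- The Alexandroff topology of the poset `X_f`: the open sets are the lower sets. -/
instance (f : G →* H) : TopologicalSpace (Xf DG DH W f) := Topology.lowerSet (Xf DG DH W f)

lemma isOpen_iff {f : G →* H} {s : Set (Xf DG DH W f)} : IsOpen s ↔ IsLowerSet s := Iff.rfl

end Xf

end Construction

end Realization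

/-! In an Alexandroff space, specialization recovers the order, so a homeomorphism is an order
isomorphism `e`. If `G` or `H` is trivial, there is only one homomorphism and nothing to show.

Otherwise each family of points has a purely order-theoretic description that does not mention the
homomorphism: first `*` (`isStar_iff`), then, relative to `*`, the points `(g, α)`, `(h, β)` and
`A_(h,0)` (`isPtG_iff`, `isPtH_iff`, `isPtA_iff`). So `e` permutes each family. The points `(g, α)`
form a Cayley-graph-like poset whose only automorphisms are left translations
(`GenSet.exists_eq_mul_left`), and likewise for `H`. Hence `e` acts on them as translations by some
`a : G` and `b : H`.

The points `D_(h,0)` tie `A_(h,0)` to the column of `h`, so `e` sends it to `A_(b * h,0)`. Since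
`(x,0) ≤ A_(h,0)` means `f x = h`, this gives `g (a * x) = b * f x` for all `x`. Taking `x = 1`
yields `g a = b`, and cancelling gives `g = f`. -/

namespace Realization

/-! ### Rigidity of the Cayley order: its automorphisms are left translations -/

namespace GenSet

variable {G : Type u} [Group G] (D : GenSet G)

/-- The order of the points `(g, α)`: the columns are ordered as the index set, and `(g, -1)` is
below `(g', δ)` if `g = g' * a` for a generator `a ≤ δ`. -/
def CayleyLE (x y : G × D.Idx) : Prop :=
  (x.1 = y.1 ∧ x.2 ≤ y.2) ∨ (x.2 = D.negOne ∧ ∃ a : D.S, D.gen a ≤ y.2 ∧ x.1 = y.1 * a)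

variable {D}

lemma idx_cases (α : D.Idx) : α = D.negOne ∨ α = D.zero ∨ ∃ a, α = D.gen a := by
  induction α using WithBot.recBotCoe with
  | bot => exact .inl rfl
  | coe α =>
    induction α using WithBot.recBotCoe with
    | bot => exact .inr (.inl rfl)
    | coe a => exact .inr (.inr ⟨a, rfl⟩)

lemma negOne_le (α : D.Idx) : D.negOne ≤ α := bot_le

lemma le_negOne {α : D.Idx} : α ≤ D.negOne ↔ α = D.negOne := le_bot_iff

lemma zero_ne_negOne : D.zero ≠ D.negOne := D.negOne_lt_zero.ne'

lemma gen_ne_negOne (a : D.S) : D.gen a ≠ D.negOne :=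
  (D.negOne_lt_zero.trans (D.zero_lt_gen a)).ne'

lemma zero_le_of_ne {α : D.Idx} (h : α ≠ D.negOne) : D.zero ≤ α := by
  rcases idx_cases α with rfl | rfl | ⟨a, rfl⟩
  · exact (h rfl).elim
  · exact le_rfl
  · exact (D.zero_lt_gen a).le

lemma MidIdx.ne_negOne (β : D.MidIdx) : β.1 ≠ D.negOne := fun h =>
  absurd β.2.1 (by rw [h]; exact not_le.2 D.negOne_lt_zero)

lemma nonempty_S [Nontrivial G] : Nonempty D.S := by
  by_contra h
  have hS : D.S = ∅ := Set.isEmpty_coe_sort.1 (not_nonempty_iff.1 h)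
  have := D.closure_eq_top
  rw [hS, Subgroup.closure_empty] at this
  exact bot_ne_top this

lemma not_isMax_zero [Nontrivial G] : ¬ IsMax D.zero := by
  obtain ⟨a⟩ := nonempty_S (D := D)
  exact not_isMax_iff.2 ⟨_, D.zero_lt_gen a⟩

/-- The index `0`, which is not the maximum when `G` is not trivial. -/
def midZero (D : GenSet G) [Nontrivial G] : D.MidIdx := ⟨D.zero, le_rfl, not_isMax_zero⟩

namespace CayleyLE

lemma refl (x : G × D.Idx) : D.CayleyLE x x := .inl ⟨rfl, le_rfl⟩

lemma of_le (g : G) {α β : D.Idx} (h : α ≤ β) : D.CayleyLE (g, α) (g, β) := .inl ⟨rfl, h⟩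

lemma of_gen (g : G) (a : D.S) : D.CayleyLE (g * a, D.negOne) (g, D.gen a) :=
  .inr ⟨rfl, a, le_rfl, rfl⟩

lemma eq_negOne {x y : G × D.Idx} (h : D.CayleyLE x y) (hy : y.2 = D.negOne) :
    x.2 = D.negOne := by
  rcases h with h | h
  · exact le_negOne.1 (hy ▸ h.2)
  · exact h.1

lemma snd_le {x y : G × D.Idx} (h : D.CayleyLE x y) : x.2 ≤ y.2 := by
  rcases h with h | h
  · exact h.2
  · rw [h.1]; exact negOne_le _

lemma eq_of_snd_eq {x y : G × D.Idx} (h : D.CayleyLE x y) (he : x.2 = y.2) : x = y := by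
  rcases h with h | ⟨h, a, ha, -⟩
  · exact Prod.ext h.1 he
  · rw [← he, h, le_negOne] at ha
    exact (gen_ne_negOne a ha).elim

lemma snd_lt {x y : G × D.Idx} (h : D.CayleyLE x y) (hne : x ≠ y) : x.2 < y.2 :=
  h.snd_le.lt_of_ne fun he => hne (h.eq_of_snd_eq he)

lemma trans {x y z : G × D.Idx} (h : D.CayleyLE x y) (h' : D.CayleyLE y z) :
    D.CayleyLE x z := by
  rcases h' with h' | h'
  · rcases h with h | ⟨h, a, ha, he⟩
    · exact .inl ⟨h.1.trans h'.1, h.2.trans h'.2⟩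
    · exact .inr ⟨h, a, ha.trans h'.2, by rw [he, h'.1]⟩
  -- Points at height `-1` are minimal, so here `x = y`.
  · have hx := h.eq_negOne h'.1
    rwa [h.eq_of_snd_eq (hx.trans h'.1.symm), CayleyLE, or_iff_right_of_imp]
    exact fun _ => h'

lemma fst_eq {x y : G × D.Idx} (h : D.CayleyLE x y) (hx : x.2 ≠ D.negOne) : x.1 = y.1 := by
  rcases h with h | h
  · exact h.1
  · exact (hx h.1).elim

lemma fst_eq_of_zero {x y : G × D.Idx} (h : D.CayleyLE x y) (hy : y.2 = D.zero) :
    x.1 = y.1 := by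
  rcases h with h | ⟨-, a, ha, -⟩
  · exact h.1
  · exact absurd (D.zero_lt_gen a) (not_lt.2 (hy ▸ ha))

end CayleyLE

/-- Along a column, the height of the image is a strictly monotone self-map of a well-order, and
such a map never decreases. -/
lemma le_snd_apply (φ : G × D.Idx ≃ G × D.Idx)
    (hφ : ∀ x y, D.CayleyLE (φ x) (φ y) ↔ D.CayleyLE x y) (x : G × D.Idx) :
    x.2 ≤ (φ x).2 := by
  have : StrictMono fun α : D.Idx => (φ (x.1, α)).2 := fun α β h =>
    ((hφ _ _).2 (.of_le x.1 h.le)).snd_lt fun he =>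
      h.ne (congrArg Prod.snd (φ.injective he))
  exact this.le_apply (x := x.2)

/-- The automorphisms of the order `CayleyLE` are the left translations. -/
theorem exists_eq_mul_left (φ : G × D.Idx ≃ G × D.Idx)
    (hφ : ∀ x y, D.CayleyLE (φ x) (φ y) ↔ D.CayleyLE x y) :
    ∃ c : G, ∀ g α, φ (g, α) = (c * g, α) := by
  have hsnd (x) : (φ x).2 = x.2 := by
    -- The inverse of `φ` does not lower heights either, so heights are preserved.
    refine (le_snd_apply φ hφ x).antisymm' ?_
    have := le_snd_apply φ.symm (fun x y => by rw [← hφ]; simp) (φ x)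
    simpa using this
  obtain ⟨τ, hτ⟩ : ∃ τ : G → G, ∀ g α, φ (g, α) = (τ g, α) := by
    refine ⟨fun g => (φ (g, D.zero)).1, fun g α => Prod.ext ?_ (hsnd _)⟩
    -- Every point of a column is comparable with its point at height `0`. The generator relations
    -- start at `-1` and end strictly above `0`, so such a comparison forces the images into one
    -- column.
    by_cases hα : α = D.negOne
    · exact ((hφ _ _).2 (.of_le g (hα ▸ negOne_le _) : D.CayleyLE (g, α) (g, D.zero))).fst_eq_of_zero
        (hsnd _)
    · exact (((hφ _ _).2 (.of_le g (zero_le_of_ne hα) :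
        D.CayleyLE (g, D.zero) (g, α))).fst_eq (by rw [hsnd]; exact zero_ne_negOne)).symm
  have hτ' : Function.Injective τ := fun g g' h => by
    have : φ (g, D.zero) = φ (g', D.zero) := by rw [hτ, hτ, h]
    exact congrArg Prod.fst (φ.injective this)
  have key (g : G) (a : D.S) : τ (g * a) = τ g * a := by
    have h := (hφ _ _).2 (CayleyLE.of_gen g a)
    rw [hτ, hτ] at h
    rcases h with h | ⟨-, b, hb, h⟩
    · have ha : (a : G) = 1 := by simpa using hτ' h.1
      exact (D.one_notMem (ha ▸ a.2)).elim
    -- So far `τ (g * a) = τ g * b` with `b ≤ a`. Pulling the relation for `b` back along `φ` gives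
    -- `a ≤ b`: the order on the generators acts as the edge labelling.
    · have h2 := CayleyLE.of_gen (τ g) b
      change τ (g * a) = τ g * b at h
      rw [← h, ← hτ, ← hτ, hφ] at h2
      rcases h2 with h2 | ⟨-, c, hc, h2⟩
      · have ha : (a : G) = 1 := by simpa using h2.1
        exact (D.one_notMem (ha ▸ a.2)).elim
      · have hca : a = c := Subtype.ext (mul_left_cancel h2)
        subst hca
        have hab : D.gen a = D.gen b := le_antisymm hc hb
        have : a = b := by simpa [gen] using hab
        rw [h, this]
  -- A map commuting with right multiplication by generators commutes with all right
  -- multiplications, hence is left multiplication by `τ 1`.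
  have hall (x : G) : ∀ g, τ (g * x) = τ g * x := by
    have hx : x ∈ Subgroup.closure D.S := D.closure_eq_top ▸ Subgroup.mem_top x
    induction hx using Subgroup.closure_induction with
    | mem x hx => exact fun g => key g ⟨x, hx⟩
    | one => simp
    | mul x y _ _ hx hy => intro g; rw [← mul_assoc, hy, hx, mul_assoc]
    | inv x _ hx =>
      intro g
      rw [eq_mul_inv_iff_mul_eq, ← hx, inv_mul_cancel_right]
  refine ⟨τ 1, fun g α => ?_⟩
  rw [hτ, ← hall, one_mul]

end GenSet

end Realization

/-! ### Explicit form of the order of `X_f` -/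

namespace Realization

variable {G : Type u} {H : Type v} [Group G] [Group H]

namespace XHG

variable {DG : GenSet G} {DH : GenSet H} {W : H → Type w}

/-- An explicit description of the order of `X_f`, extended to `X_H^G` by putting the points of the
sets `W_h` above all points. -/
def Le (f : G →* H) : XHG DG DH W → XHG DG DH W → Prop
  | _, ptW _ _ => True
  | star, star => True
  | star, ptG _ _ => True
  | star, aux .A _ β => β.1 = DH.zero
  | ptG g α, ptG g' α' => DG.CayleyLE (g, α) (g', α')
  | ptG g α, aux .A h β => β.1 = DH.zero ∧ ∃ x, f x = h ∧ DG.CayleyLE (g, α) (x, DG.zero)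
  | ptH _ α, star => α = DH.negOne
  | ptH _ α, ptG _ _ => α = DH.negOne
  | ptH h α, ptH h' α' => DH.CayleyLE (h, α) (h', α')
  | ptH _ α, aux .A _ β => β.1 = DH.zero ∧ α = DH.negOne
  | ptH h α, aux .B h' β => DH.CayleyLE (h, α) (h', β.1)
  | ptH h α, aux .E h' β => DH.CayleyLE (h, α) (h', β.1)
  | aux .D h β, ptH h' β' => h = h' ∧ β.1 ≤ β'
  | aux .H h β, ptH h' β' => h = h' ∧ β.1 ≤ β'
  | aux .D h β, aux .B h' β' => h = h' ∧ β.1 ≤ β'.1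
  | aux .H h β, aux .B h' β' => h = h' ∧ β.1 ≤ β'.1
  | aux .D h β, aux .E h' β' => h = h' ∧ β.1 ≤ β'.1
  | aux .H h β, aux .E h' β' => h = h' ∧ β.1 ≤ β'.1
  | aux .C h β, aux .A h' β' => h = h' ∧ β = β'
  | aux .D h β, aux .A h' β' => h = h' ∧ β = β'
  | aux .C h β, aux .B h' β' => h = h' ∧ β = β'
  | aux .I h β, aux .E h' β' => h = h' ∧ β = β'
  | aux .H h β, aux .F h' β' => h = h' ∧ β = β'
  | aux .J h β, aux .F h' β' => h = h' ∧ β = β'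
  | aux .I h β, aux .G h' β' => h = h' ∧ β = β'
  | aux .J h β, aux .G h' β' => h = h' ∧ β = β'
  | aux l h β, aux m h' β' => l = m ∧ h = h' ∧ β = β'
  | _, _ => False

lemma Le.refl (f : G →* H) (p : XHG DG DH W) : Le f p p := by
  rcases p with _ | _ | _ | ⟨_ | _, _, _⟩ | _ <;> simp [Le, GenSet.CayleyLE.refl]

/-- With `Le.refl` and `Le.basic`, this shows that `Le` contains the generated order: it contains
the diagonal and absorbs generators on the right, so transitivity of `Le` itself is never needed. -/
lemma Le.new {f : G →* H} {p q r : XHG DG DH W} (h : Le f p q) (h' : New f q r) : Le f p r := by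
  cases h' with
  | fiber g β hβ =>
    rcases p with _ | _ | _ | ⟨_ | _, _, _⟩ | _ <;> simp_all [Le]
    exact ⟨g, rfl, h⟩
  | notRange k hk β hβ =>
    rcases p with _ | _ | _ | ⟨_ | _, _, _⟩ | _ <;> simp_all [Le]

variable [∀ h, LinearOrder (W h)]

lemma Le.basic {f : G →* H} {p q r : XHG DG DH W} (h : Le f p q) (h' : Basic q r) : Le f p r := by
  cases h' with
  | colG g hαδ =>
    rcases p with _ | _ | _ | ⟨_ | _, _, _⟩ | _ <;> simp_all [Le]
    exact h.trans (.of_le _ hαδ.le)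
  | genG g a =>
    rcases p with _ | _ | _ | ⟨_ | _, _, _⟩ | _ <;> simp_all [Le]
    exact h.trans (.of_gen _ _)
  | starG g =>
    rcases p with _ | _ | _ | ⟨_ | _, _, _⟩ | _ <;> simp_all [Le]
  | colH k hβγ =>
    rcases p with _ | _ | _ | ⟨_ | _, _, _⟩ | _ <;> simp_all [Le]
    · exact h.trans (.of_le _ hβγ.le)
    · exact h.2.trans hβγ.le
    · exact h.2.trans hβγ.le
  | genH k b =>
    rcases p with _ | _ | _ | ⟨_ | _, _, β⟩ | _ <;> simp_all [Le]
    · exact h.trans (.of_gen _ _)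
    · exact (GenSet.MidIdx.ne_negOne β (GenSet.le_negOne.1 h.2)).elim
    · exact (GenSet.MidIdx.ne_negOne β (GenSet.le_negOne.1 h.2)).elim
  | hstar k =>
    rcases p with _ | _ | _ | ⟨_ | _, _, β⟩ | _ <;> simp_all [Le]
    · exact h.eq_negOne rfl
    · exact (GenSet.MidIdx.ne_negOne β (GenSet.le_negOne.1 h.2)).elim
    · exact (GenSet.MidIdx.ne_negOne β (GenSet.le_negOne.1 h.2)).elim
  | Dh k β =>
    rcases p with _ | _ | _ | ⟨_ | _, _, β⟩ | _ <;> simp_all [Le]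
  | Hh k β =>
    rcases p with _ | _ | _ | ⟨_ | _, _, β⟩ | _ <;> simp_all [Le]
  | wellW _ _ => simp [Le]
  | AW _ _ _ _ _ => simp [Le]
  | _ => rcases p with _ | _ | _ | ⟨_ | _, _, _⟩ | _ <;> simp_all [Le]

lemma Le.trans_le {f : G →* H} {o p q : XHG DG DH W} (ho : Le f o p) (h : p ≤ q) :
    Le f o q := by
  induction (h : Relation.ReflTransGen Basic p q) with
  | refl => exact ho
  | tail _ h ih => exact ih.basic h

end XHG

namespace Xf

variable {DG : GenSet G} {DH : GenSet H} {W : H → Type w}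
  {f : G →* H}

lemma carrier_eq [Nontrivial G] [Nontrivial H] :
    XHG.carrier DG DH W = XHG.withoutW DG DH W := by
  simp [XHG.carrier, not_subsingleton]

variable (DG DH W f) in
/-- The point `*` of `X_f`. -/
def star [Nontrivial G] [Nontrivial H] : Xf DG DH W f :=
  ⟨.star, by simp [carrier_eq, XHG.withoutW]⟩

variable (DG DH W f) in
/-- The points `(g, α)` of `X_f`. -/
def ptG [Nontrivial G] [Nontrivial H] (x : G × DG.Idx) : Xf DG DH W f :=
  ⟨.ptG x.1 x.2, by simp [carrier_eq, XHG.withoutW]⟩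

variable (DG DH W f) in
/-- The points `(h, β)` of `X_f`. -/
def ptH [Nontrivial G] [Nontrivial H] (x : H × DH.Idx) : Xf DG DH W f :=
  ⟨.ptH x.1 x.2, by simp [carrier_eq, XHG.withoutW]⟩

variable (DG DH W f) in
/-- The points `A_(h, β)`, …, `J_(h, β)` of `X_f`. -/
def aux [Nontrivial G] [Nontrivial H] (l : Letter) (h : H) (β : DH.MidIdx) : Xf DG DH W f :=
  ⟨.aux l h β, by simp [carrier_eq, XHG.withoutW]⟩

@[elab_as_elim]
lemma cases_point [Nontrivial G] [Nontrivial H] {P : Xf DG DH W f → Prop} (p : Xf DG DH W f)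
    (star : P (star DG DH W f)) (ptG : ∀ x, P (ptG DG DH W f x)) (ptH : ∀ x, P (ptH DG DH W f x))
    (aux : ∀ l h β, P (aux DG DH W f l h β)) : P p := by
  rcases p with ⟨_ | ⟨g, α⟩ | ⟨h, β⟩ | ⟨l, h, β⟩ | ⟨h, x⟩, hp⟩
  · exact star
  · exact ptG (g, α)
  · exact ptH (h, β)
  · exact aux l h β
  · rw [carrier_eq] at hp
    exact (hp h x rfl).elim

variable [∀ h, LinearOrder (W h)]

lemma val_Le_of_le {p q : Xf DG DH W f} (h : p ≤ q) : XHG.Le f p.1 q.1 := by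
  induction (h : Relation.ReflTransGen Basic p q) with
  | refl => exact .refl f _
  | tail _ h ih =>
    rcases h with h | ⟨_, _, h⟩
    · exact ih.trans_le h
    · exact ih.new h

lemma le_of_basic {p q : Xf DG DH W f} (h : XHG.Basic p.1 q.1) : p ≤ q :=
  Relation.ReflTransGen.single (.inl (Relation.ReflTransGen.single h))

variable [Nontrivial G] [Nontrivial H]

lemma le_of_new {p q : Xf DG DH W f} (h : XHG.New f p.1 q.1) : p ≤ q :=
  Relation.ReflTransGen.single (.inr ⟨inferInstance, inferInstance, h⟩)

lemma ptG_le_of_le (g : G) {α β : DG.Idx} (h : α ≤ β) :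
    ptG DG DH W f (g, α) ≤ ptG DG DH W f (g, β) := by
  rcases h.eq_or_lt with rfl | h
  · exact le_rfl
  · exact le_of_basic (.colG g h)

lemma ptH_le_of_le (g : H) {α β : DH.Idx} (h : α ≤ β) :
    ptH DG DH W f (g, α) ≤ ptH DG DH W f (g, β) := by
  rcases h.eq_or_lt with rfl | h
  · exact le_rfl
  · exact le_of_basic (.colH g h)

lemma ptG_le_of_cayley {x y : G × DG.Idx} (h : DG.CayleyLE x y) :
    ptG DG DH W f x ≤ ptG DG DH W f y := by
  rcases x with ⟨g, α⟩
  rcases y with ⟨g', δ⟩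
  rcases h with ⟨rfl, h⟩ | ⟨rfl, a, ha, rfl⟩
  · exact ptG_le_of_le g h
  · exact le_trans (le_of_basic (q := ptG DG DH W f (g', DG.gen a)) (.genG g' a)) (ptG_le_of_le g' ha)

lemma ptH_le_of_cayley {x y : H × DH.Idx} (h : DH.CayleyLE x y) :
    ptH DG DH W f x ≤ ptH DG DH W f y := by
  rcases x with ⟨g, α⟩
  rcases y with ⟨g', δ⟩
  rcases h with ⟨rfl, h⟩ | ⟨rfl, a, ha, rfl⟩
  · exact ptH_le_of_le g h
  · exact le_trans (le_of_basic (q := ptH DG DH W f (g', DH.gen a)) (.genH g' a)) (ptH_le_of_le g' ha)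

lemma star_le_ptG (x : G × DG.Idx) : star DG DH W f ≤ ptG DG DH W f x :=
  le_trans (le_of_basic (q := ptG DG DH W f (x.1, DG.negOne)) (.starG x.1)) (ptG_le_of_le x.1 (GenSet.negOne_le x.2))

lemma ptG_le_A {g : G} {β : DH.MidIdx} (hβ : β.1 = DH.zero) :
    ptG DG DH W f (g, DG.zero) ≤ aux DG DH W f .A (f g) β :=
  le_of_new (.fiber g β hβ)

/-- Over the range of `f` the relation passes through some `(g, 0)`; elsewhere it was added by hand.
Thus the set of `A_(h,0)` can be recognized from `*` independently of `f`. -/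
lemma star_le_A (h : H) {β : DH.MidIdx} (hβ : β.1 = DH.zero) :
    star DG DH W f ≤ aux DG DH W f .A h β := by
  by_cases hh : h ∈ Set.range f
  · obtain ⟨g, rfl⟩ := hh
    exact (star_le_ptG _).trans (ptG_le_A hβ)
  · exact le_of_new (.notRange h hh β hβ)

lemma ptH_le_star (h : H) : ptH DG DH W f (h, DH.negOne) ≤ star DG DH W f :=
  le_of_basic (.hstar h)

lemma le_iff {p q : Xf DG DH W f} : p ≤ q ↔ XHG.Le f p.1 q.1 := by
  refine ⟨val_Le_of_le, fun h => ?_⟩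
  have hB (k β) : ptH DG DH W f (k, β.1) ≤ aux DG DH W f .B k β := le_of_basic (.hB k β)
  have hE (k β) : ptH DG DH W f (k, β.1) ≤ aux DG DH W f .E k β := le_of_basic (.hE k β)
  have hD (k) (β : DH.MidIdx) (γ) (h : β.1 ≤ γ) : aux DG DH W f .D k β ≤ ptH DG DH W f (k, γ) :=
    le_trans (le_of_basic (q := ptH DG DH W f (k, β.1)) (.Dh k β)) (ptH_le_of_le k h)
  have hH (k) (β : DH.MidIdx) (γ) (h : β.1 ≤ γ) : aux DG DH W f .H k β ≤ ptH DG DH W f (k, γ) :=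
    le_trans (le_of_basic (q := ptH DG DH W f (k, β.1)) (.Hh k β)) (ptH_le_of_le k h)
  induction p using cases_point with
  | star =>
    induction q using cases_point with
    | star => exact le_rfl
    | ptG x => exact star_le_ptG x
    | ptH x => exact h.elim
    | aux l k β =>
      cases l <;> first | exact star_le_A k h | exact h.elim
  | ptG x =>
    induction q using cases_point with
    | star => exact h.elim
    | ptG y => exact ptG_le_of_cayley h
    | ptH y => exact h.elim
    | aux l k β =>
      cases l with
      | A =>
        obtain ⟨hβ, g, rfl, h⟩ := h
        exact (ptG_le_of_cayley h).trans (ptG_le_A hβ)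
      | _ => exact h.elim
  | ptH x =>
    rcases x with ⟨g, α⟩
    induction q using cases_point with
    | star => cases h; exact ptH_le_star _
    | ptG y => cases h; exact (ptH_le_star _).trans (star_le_ptG y)
    | ptH y => exact ptH_le_of_cayley h
    | aux l k β =>
      cases l with
      | A =>
        obtain ⟨hβ, h⟩ := h
        cases h
        exact (ptH_le_star _).trans (star_le_A k hβ)
      | B => exact (ptH_le_of_cayley h).trans (hB k β)
      | E => exact (ptH_le_of_cayley h).trans (hE k β)
      | _ => exact h.elim
  | aux m t γ =>
    induction q using cases_point with
    | star => cases m <;> exact h.elim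
    | ptG y => cases m <;> exact h.elim
    | ptH y =>
      cases m with
      | D => obtain ⟨rfl, h⟩ := h; exact hD _ _ _ h
      | H => obtain ⟨rfl, h⟩ := h; exact hH _ _ _ h
      | _ => exact h.elim
    | aux l k β =>
      cases m <;> cases l <;> first
        | (obtain ⟨-, rfl, rfl⟩ := h; exact le_rfl)
        | (obtain ⟨rfl, h⟩ := h; exact (hD _ _ _ h).trans (hB _ _))
        | (obtain ⟨rfl, h⟩ := h; exact (hD _ _ _ h).trans (hE _ _))
        | (obtain ⟨rfl, h⟩ := h; exact (hH _ _ _ h).trans (hB _ _))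
        | (obtain ⟨rfl, h⟩ := h; exact (hH _ _ _ h).trans (hE _ _))
        | (obtain ⟨rfl, rfl⟩ := h; exact le_of_basic (by constructor))
        | exact absurd h.1 (by simp)

end Xf

end Realization

/-! ### Order-theoretic descriptions and their invariance under isomorphisms -/

namespace Realization

/-- The letters that name minimal points. -/
def Letter.IsLow : Letter → Prop
  | .C | .D | .H | .I | .J => True
  | _ => False

/-- An order-theoretic description of the point `*` of `X_f`. -/
def IsStar {α : Type*} [PartialOrder α] (p : α) : Prop :=
  ¬ IsMin p ∧ ∀ x, x < p → IsMin x ∧ ∀ y, x < y → IsMax y → ∃ z, z < y ∧ ¬ IsMin z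

/-- An order-theoretic description, with `s = *`, of the points `(g, α)` of `X_f`. -/
def IsPtG {α : Type*} [PartialOrder α] (s p : α) : Prop :=
  s < p ∧ ∀ q, q < p → q ≤ s ∨ s ≤ q

/-- An order-theoretic description, with `s = *`, of the points `(h, β)` of `X_f`. -/
def IsPtH {α : Type*} [PartialOrder α] (s p : α) : Prop :=
  (∃ k, k < s ∧ k ≤ p) ∧ ¬ s ≤ p ∧ ∀ q, q ≤ p → IsMin q → ∃ r, q < r ∧ ¬ IsMax r

/-- An order-theoretic description, with `s = *`, of the points `A_(h, 0)` of `X_f`. -/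
def IsPtA {α : Type*} [PartialOrder α] (s p : α) : Prop :=
  s < p ∧ ∃ q, q < p ∧ ¬ (q ≤ s ∨ s ≤ q)

section

variable {α β : Type*} [PartialOrder α] [PartialOrder β] (e : α ≃o β)

lemma isStar_apply {p : α} : IsStar (e p) ↔ IsStar p := by
  simp only [IsStar, e.surjective.forall, e.surjective.exists, e.lt_iff_lt,
    e.isMin_apply, e.isMax_apply]

lemma isPtG_apply {s p : α} : IsPtG (e s) (e p) ↔ IsPtG s p := by
  simp [IsPtG, e.surjective.forall]

lemma isPtH_apply {s p : α} : IsPtH (e s) (e p) ↔ IsPtH s p := by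
  simp only [IsPtH, e.surjective.forall, e.surjective.exists, e.lt_iff_lt, e.le_iff_le,
    e.isMin_apply, e.isMax_apply]

lemma isPtA_apply {s p : α} : IsPtA (e s) (e p) ↔ IsPtA s p := by
  simp [IsPtA, e.surjective.exists]

lemma exists_equiv_of_mem_range_iff {α β X : Type*} (e : α ≃ β) {i : X → α} {j : X → β}
    (hi : Function.Injective i) (hj : Function.Injective j)
    (h : ∀ p, e p ∈ Set.range j ↔ p ∈ Set.range i) : ∃ φ : X ≃ X, ∀ x, e (i x) = j (φ x) := by
  choose φ hφ using fun x => (h (i x)).2 ⟨x, rfl⟩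
  choose ψ hψ using fun x => (h (e.symm (j x))).1 ⟨x, by simp⟩
  refine ⟨⟨φ, ψ, fun x => hi ?_, fun x => hj ?_⟩, fun x => (hφ x).symm⟩
  · rw [hψ, hφ, e.symm_apply_apply]
  · rw [hφ, hψ, e.apply_symm_apply]

end

/-! ### Recognizing the points of `X_f` and recovering `f` -/

namespace Xf

variable {G : Type u} {H : Type v} [Group G] [Group H]
variable {DG : GenSet G} {DH : GenSet H} {W : H → Type w}
  {f : G →* H} [∀ h, LinearOrder (W h)] [Nontrivial G] [Nontrivial H]

omit [∀ h, LinearOrder (W h)] in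
@[simp] lemma val_star : (star DG DH W f).1 = .star := rfl

omit [∀ h, LinearOrder (W h)] in
@[simp] lemma val_ptG (x) : (ptG DG DH W f x).1 = .ptG x.1 x.2 := rfl

omit [∀ h, LinearOrder (W h)] in
@[simp] lemma val_ptH (x) : (ptH DG DH W f x).1 = .ptH x.1 x.2 := rfl

omit [∀ h, LinearOrder (W h)] in
@[simp] lemma val_aux (l h β) : (aux DG DH W f l h β).1 = .aux l h β := rfl

omit [∀ h, LinearOrder (W h)] in
lemma ptG_injective : Function.Injective (ptG DG DH W f) := fun x y h => by
  simpa [Prod.ext_iff] using congrArg Subtype.val h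

omit [∀ h, LinearOrder (W h)] in
lemma ptH_injective : Function.Injective (ptH DG DH W f) := fun x y h => by
  simpa [Prod.ext_iff] using congrArg Subtype.val h

lemma lt_iff {p q : Xf DG DH W f} : p < q ↔ XHG.Le f p.1 q.1 ∧ p.1 ≠ q.1 := by
  rw [lt_iff_le_and_ne, le_iff]
  exact and_congr_right fun _ => not_congr Subtype.ext_iff

lemma ptG_le_ptG {x y : G × DG.Idx} :
    ptG DG DH W f x ≤ ptG DG DH W f y ↔ DG.CayleyLE x y := le_iff

lemma ptH_le_ptH {x y : H × DH.Idx} :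
    ptH DG DH W f x ≤ ptH DG DH W f y ↔ DH.CayleyLE x y := le_iff

lemma isMin_negOne (h : H) : IsMin (ptH DG DH W f (h, DH.negOne)) := by
  intro p hp
  induction p using cases_point with
  | star => simp [le_iff, XHG.Le] at hp
  | ptG x => simp [le_iff, XHG.Le] at hp
  | ptH x => exact (congrArg _ ((ptH_le_ptH.1 hp).eq_of_snd_eq
      ((ptH_le_ptH.1 hp).eq_negOne rfl))).ge
  | aux l k β =>
    cases l <;> simp [le_iff, XHG.Le, GenSet.le_negOne, GenSet.MidIdx.ne_negOne] at hp

lemma not_isMin_star : ¬ IsMin (star DG DH W f) :=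
  not_isMin_iff.2 ⟨ptH DG DH W f (1, DH.negOne), by simp [lt_iff, XHG.Le]⟩

lemma not_isMin_ptH {x : H × DH.Idx} (hx : x.2 ≠ DH.negOne) : ¬ IsMin (ptH DG DH W f x) :=
  not_isMin_iff.2 ⟨aux DG DH W f .D x.1 DH.midZero, by
    simpa [lt_iff, XHG.Le, GenSet.midZero] using GenSet.zero_le_of_ne hx⟩

lemma not_isMax_star : ¬ IsMax (star DG DH W f) :=
  not_isMax_iff.2 ⟨ptG DG DH W f (1, DG.negOne), by simp [lt_iff, XHG.Le]⟩

lemma not_isMax_ptH (h : H) (β : DH.MidIdx) : ¬ IsMax (ptH DG DH W f (h, β.1)) :=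
  not_isMax_iff.2 ⟨aux DG DH W f .B h β, by simp [lt_iff, XHG.Le, GenSet.CayleyLE.refl]⟩

lemma isMin_aux {l : Letter} (hl : l.IsLow) (h : H) (β) : IsMin (aux DG DH W f l h β) := by
  intro p hp
  rw [le_iff] at *
  induction p using cases_point with
  | star => cases l <;> simp [XHG.Le, Letter.IsLow] at *
  | ptG x => cases l <;> simp [XHG.Le, Letter.IsLow] at *
  | ptH x => cases l <;> simp [XHG.Le, Letter.IsLow] at *
  | aux m k γ => cases l <;> cases m <;> simp [XHG.Le, Letter.IsLow] at * <;> simp [hp]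

lemma isMax_aux {l : Letter} (hl : ¬ l.IsLow) (h : H) (β) : IsMax (aux DG DH W f l h β) := by
  intro p hp
  rw [le_iff] at *
  induction p using cases_point with
  | star => cases l <;> simp [XHG.Le, Letter.IsLow] at *
  | ptG x => cases l <;> simp [XHG.Le, Letter.IsLow] at *
  | ptH x => cases l <;> simp [XHG.Le, Letter.IsLow] at *
  | aux m k γ => cases l <;> cases m <;> simp [XHG.Le, Letter.IsLow] at * <;> simp [hp]

lemma isMin_of_lt_F {h : H} {β : DH.MidIdx} {p} (hp : p < aux DG DH W f .F h β) : IsMin p := by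
  rw [lt_iff] at hp
  induction p using cases_point with
  | aux m k γ =>
    refine isMin_aux ?_ k γ
    cases m <;> simp_all [XHG.Le, Letter.IsLow]
    exact hp.2 hp.1.1 hp.1.2
  | _ => simp [XHG.Le] at hp

lemma isMin_of_lt_G {h : H} {β : DH.MidIdx} {p} (hp : p < aux DG DH W f .G h β) : IsMin p := by
  rw [lt_iff] at hp
  induction p using cases_point with
  | aux m k γ =>
    refine isMin_aux ?_ k γ
    cases m <;> simp_all [XHG.Le, Letter.IsLow]
    exact hp.2 hp.1.1 hp.1.2
  | _ => simp [XHG.Le] at hp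

lemma isMin_of_lt_A {h : H} {β : DH.MidIdx} (hβ : β.1 ≠ DH.zero) {p}
    (hp : p < aux DG DH W f .A h β) : IsMin p := by
  rw [lt_iff] at hp
  induction p using cases_point with
  | aux m k γ =>
    refine isMin_aux ?_ k γ
    cases m <;> simp_all [XHG.Le, Letter.IsLow]
    exact hp.2 hp.1.1 hp.1.2
  | _ => simp [XHG.Le, hβ] at hp

lemma isStar_star : IsStar (star DG DH W f) := by
  refine ⟨not_isMin_star, fun x hx => ?_⟩
  obtain ⟨h, rfl⟩ : ∃ h, x = ptH DG DH W f (h, DH.negOne) := by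
    rw [lt_iff] at hx
    induction x using cases_point with
    | ptH x => exact ⟨x.1, Subtype.ext (by simp_all [XHG.Le])⟩
    | aux l k β => cases l <;> simp [XHG.Le] at hx
    | _ => simp [XHG.Le] at hx
  refine ⟨isMin_negOne h, fun y hy hm => ?_⟩
  induction y using cases_point with
  | star => exact (not_isMax_star hm).elim
  | ptG x => exact ⟨star DG DH W f, by simp [lt_iff, XHG.Le], not_isMin_star⟩
  | ptH x =>
    have hx : x.2 ≠ DH.negOne := fun hx =>
      (isMin_negOne (DG := DG) (W := W) (f := f) x.1).not_lt (by rw [← hx]; exact hy)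
    refine ⟨ptH DG DH W f (x.1, DH.zero), ?_, not_isMin_ptH GenSet.zero_ne_negOne⟩
    rw [lt_iff_le_and_ne]
    refine ⟨ptH_le_of_le _ (GenSet.zero_le_of_ne hx), fun he => ?_⟩
    exact not_isMax_ptH x.1 DH.midZero (he ▸ hm :)
  | aux l k β =>
    rw [lt_iff] at hy
    cases l with
    | A => exact ⟨star DG DH W f, by simp_all [lt_iff, XHG.Le], not_isMin_star⟩
    | B => exact ⟨ptH DG DH W f (k, β.1), by simp [lt_iff, XHG.Le, GenSet.CayleyLE.refl],
        not_isMin_ptH (GenSet.MidIdx.ne_negOne β)⟩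
    | E => exact ⟨ptH DG DH W f (k, β.1), by simp [lt_iff, XHG.Le, GenSet.CayleyLE.refl],
        not_isMin_ptH (GenSet.MidIdx.ne_negOne β)⟩
    | _ => simp [XHG.Le] at hy

/-- Any other non-minimal point fails in one of two ways. Either it has a non-minimal point strictly
below it (`*` or some `(h, β)`), or it lies above a point that is below a maximal point with only
minimal points beneath it: `F`, `G`, or `A_(h,β)` with `β ≠ 0`. -/
lemma isStar_iff {p : Xf DG DH W f} : IsStar p ↔ p = star DG DH W f := by
  refine ⟨fun ⟨h1, h2⟩ => ?_, fun h => h ▸ isStar_star⟩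
  have hF (h : H) (β : DH.MidIdx) : aux DG DH W f .H h β < aux DG DH W f .F h β := by
    simp [lt_iff, XHG.Le]
  have contr {x y : Xf DG DH W f} (hx : x < p) (hxy : x < y) (hy : IsMax y)
      (hz : ∀ z, z < y → IsMin z) : p = star DG DH W f := by
    obtain ⟨z, hz', hz''⟩ := (h2 x hx).2 y hxy hy
    exact (hz'' (hz z hz')).elim
  induction p using cases_point with
  | star => rfl
  | ptG x => exact (not_isMin_star (h2 _ (by simp [lt_iff, XHG.Le])).1).elim
  | ptH x =>
    have hx : x.2 ≠ DH.negOne := by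
      intro hx
      refine h1 ?_
      have := isMin_negOne (DG := DG) (DH := DH) (W := W) (f := f) x.1
      rwa [← hx] at this
    refine contr ?_ (hF x.1 DH.midZero) (isMax_aux (by simp [Letter.IsLow]) _ _)
      fun z => isMin_of_lt_F
    simpa [lt_iff, XHG.Le, GenSet.midZero] using GenSet.zero_le_of_ne hx
  | aux l k β =>
    have hB := not_isMin_ptH (DG := DG) (W := W) (f := f) (x := (k, β.1))
      (GenSet.MidIdx.ne_negOne β)
    cases l with
    | A =>
      by_cases hβ : β.1 = DH.zero
      · exact (not_isMin_star (h2 _ (by simpa [lt_iff, XHG.Le] using hβ)).1).elim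
      · have hC : aux DG DH W f .C k β < aux DG DH W f .A k β := by simp [lt_iff, XHG.Le]
        exact contr hC hC (isMax_aux (by simp [Letter.IsLow]) _ _) fun z => isMin_of_lt_A hβ
    | B => exact (hB (h2 _ (by simp [lt_iff, XHG.Le, GenSet.CayleyLE.refl])).1).elim
    | E => exact (hB (h2 _ (by simp [lt_iff, XHG.Le, GenSet.CayleyLE.refl])).1).elim
    | F =>
      exact contr (hF k β) (hF k β) (isMax_aux (by simp [Letter.IsLow]) _ _)
        fun z => isMin_of_lt_F
    | G =>
      have hI : aux DG DH W f .I k β < aux DG DH W f .G k β := by simp [lt_iff, XHG.Le]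
      exact contr hI hI (isMax_aux (by simp [Letter.IsLow]) _ _) fun z => isMin_of_lt_G
    | _ => exact (h1 (isMin_aux (by simp [Letter.IsLow]) k β)).elim

lemma isPtG_iff {p : Xf DG DH W f} :
    IsPtG (star DG DH W f) p ↔ p ∈ Set.range (ptG DG DH W f) := by
  constructor
  · rintro ⟨h1, h2⟩
    rw [lt_iff] at h1
    induction p using cases_point with
    | ptG x => exact ⟨x, rfl⟩
    | aux l k β =>
      cases l with
      | A =>
        -- `C` lies below `A` but is incomparable with `*`, which separates `A_(h,0)` from the
        -- points `(g, α)`.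
        have := h2 (aux DG DH W f .C k β) (by simp [lt_iff, XHG.Le])
        simp [le_iff, XHG.Le] at this
      | _ => simp [XHG.Le] at h1
    | _ => simp [XHG.Le] at h1
  · rintro ⟨x, rfl⟩
    refine ⟨by simp [lt_iff, XHG.Le], fun q hq => ?_⟩
    rw [lt_iff] at hq
    rw [le_iff, le_iff]
    induction q using cases_point with
    | aux l k β => cases l <;> simp [XHG.Le] at hq
    | _ => simp_all [XHG.Le]

lemma isPtA_iff {p : Xf DG DH W f} :
    IsPtA (star DG DH W f) p ↔ ∃ h, p = aux DG DH W f .A h DH.midZero := by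
  constructor
  · rintro ⟨h1, q, h2, h3⟩
    have hG : ¬ IsPtG (star DG DH W f) p := fun h => h3 (h.2 q h2)
    rw [isPtG_iff] at hG
    rw [lt_iff] at h1
    induction p using cases_point with
    | ptG x => exact (hG ⟨x, rfl⟩).elim
    | aux l k β =>
      cases l with
      | A => exact ⟨k, congrArg _ (Subtype.ext h1.1)⟩
      | _ => simp [XHG.Le] at h1
    | _ => simp [XHG.Le] at h1
  · rintro ⟨k, rfl⟩
    exact ⟨by simp [lt_iff, XHG.Le, GenSet.midZero], aux DG DH W f .C k DH.midZero,
      by simp [lt_iff, XHG.Le], by simp [le_iff, XHG.Le]⟩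

lemma isPtH_iff {p : Xf DG DH W f} :
    IsPtH (star DG DH W f) p ↔ p ∈ Set.range (ptH DG DH W f) := by
  constructor
  · rintro ⟨⟨k, hk, hkp⟩, h1, h2⟩
    -- Only maximal points lie strictly above `C` or `I`, so the last clause of `IsPtH` excludes
    -- every point above one of them.
    have low {m : Letter} (t : H) (γ : DH.MidIdx) (hm : m = .C ∨ m = .I)
        (hp : aux DG DH W f m t γ ≤ p) : False := by
      obtain ⟨r, hr, hr'⟩ := h2 _ hp (isMin_aux (by rcases hm with rfl | rfl <;> trivial) t γ)
      rw [lt_iff] at hr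
      refine hr' ?_
      induction r using cases_point with
      | aux l k β =>
        refine isMax_aux ?_ k β
        rcases hm with rfl | rfl <;> cases l <;> simp_all [XHG.Le, Letter.IsLow] <;>
          exact hr.2 hr.1.1 hr.1.2
      | _ => rcases hm with rfl | rfl <;> simp [XHG.Le] at hr
    induction p using cases_point with
    | star => exact (h1 le_rfl).elim
    | ptG x => exact (h1 (star_le_ptG x)).elim
    | ptH x => exact ⟨x, rfl⟩
    | aux l t β =>
      cases l with
      | A => exact (low (m := .C) t β (.inl rfl) (by simp [le_iff, XHG.Le])).elim
      | B => exact (low (m := .C) t β (.inl rfl) (by simp [le_iff, XHG.Le])).elim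
      | E => exact (low (m := .I) t β (.inr rfl) (by simp [le_iff, XHG.Le])).elim
      | G => exact (low (m := .I) t β (.inr rfl) (by simp [le_iff, XHG.Le])).elim
      | C => exact (low (m := .C) t β (.inl rfl) le_rfl).elim
      | I => exact (low (m := .I) t β (.inr rfl) le_rfl).elim
      | _ =>
        exfalso
        rw [lt_iff] at hk
        rw [le_iff] at hkp
        induction k using cases_point with
        | aux m t γ => cases m <;> simp [XHG.Le] at hk
        | _ => simp [XHG.Le] at hk hkp
  · rintro ⟨x, rfl⟩
    refine ⟨⟨ptH DG DH W f (x.1, DH.negOne), by simp [lt_iff, XHG.Le],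
      ptH_le_of_le _ (GenSet.negOne_le _)⟩, by simp [le_iff, XHG.Le], fun q hq hm => ?_⟩
    induction q using cases_point with
    | ptH y =>
      by_cases hy : y.2 = DH.negOne
      · exact ⟨star DG DH W f, by simpa [lt_iff, XHG.Le] using hy, not_isMax_star⟩
      · exact (not_isMin_ptH hy hm).elim
    | aux l k β =>
      refine ⟨ptH DG DH W f (k, β.1), ?_, not_isMax_ptH k β⟩
      rw [le_iff] at hq
      cases l <;> simp_all [lt_iff, XHG.Le]
    | _ => simp [le_iff, XHG.Le] at hq

/-- The witness is `D`. A point `(t, γ)` below `A_(k,0)` has height `-1`, so it lies below `*` and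
is excluded; this makes the index of `A_(k,0)` visible in the order. -/
lemma exists_le_A_le_ptH_iff {h k : H} :
    (∃ q, q ≤ aux DG DH W f .A k DH.midZero ∧ q ≤ ptH DG DH W f (h, DH.zero) ∧
      ¬ q ≤ star DG DH W f) ↔ k = h := by
  constructor
  · rintro ⟨q, h1, h2, h3⟩
    rw [le_iff] at h1 h2 h3
    induction q using cases_point with
    | ptH x => simp_all [XHG.Le]
    | aux l t β => cases l <;> simp_all [XHG.Le]
    | _ => simp [XHG.Le] at h2
  · rintro rfl
    exact ⟨aux DG DH W f .D k DH.midZero, by simp [le_iff, XHG.Le],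
      by simp [le_iff, XHG.Le, GenSet.midZero], by simp [le_iff, XHG.Le]⟩

lemma ptG_zero_le_A_iff {g : G} {h : H} :
    ptG DG DH W f (g, DG.zero) ≤ aux DG DH W f .A h DH.midZero ↔ f g = h := by
  rw [le_iff]
  constructor
  · rintro ⟨-, x, rfl, hx⟩
    rw [show g = x from hx.fst_eq_of_zero rfl]
  · rintro rfl
    exact ⟨rfl, g, rfl, .refl _⟩

/-- The homomorphism is determined by the order of `X_f`. -/
theorem eq_of_orderIso {f g : G →* H} (e : Xf DG DH W f ≃o Xf DG DH W g) : f = g := by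
  have hs : e (star DG DH W f) = star DG DH W g :=
    isStar_iff.1 ((isStar_apply e).2 isStar_star)
  obtain ⟨φ, hφ⟩ := exists_equiv_of_mem_range_iff e.toEquiv (ptG_injective (DG := DG) (W := W))
    (ptG_injective (DG := DG) (DH := DH) (W := W) (f := g)) fun p => by
      rw [← isPtG_iff, ← isPtG_iff, ← hs]; exact isPtG_apply e
  obtain ⟨ψ, hψ⟩ := exists_equiv_of_mem_range_iff e.toEquiv (ptH_injective (DG := DG) (W := W))
    (ptH_injective (DG := DG) (DH := DH) (W := W) (f := g)) fun p => by
      rw [← isPtH_iff, ← isPtH_iff, ← hs]; exact isPtH_apply e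
  have hφ' (x) : e (ptG DG DH W f x) = ptG DG DH W g (φ x) := hφ x
  have hψ' (x) : e (ptH DG DH W f x) = ptH DG DH W g (ψ x) := hψ x
  obtain ⟨a, ha⟩ := GenSet.exists_eq_mul_left φ fun x y => by
    rw [← ptG_le_ptG (DH := DH) (W := W) (f := g), ← hφ', ← hφ', e.le_iff_le, ptG_le_ptG]
  obtain ⟨b, hb⟩ := GenSet.exists_eq_mul_left ψ fun x y => by
    rw [← ptH_le_ptH (DG := DG) (W := W) (f := g), ← hψ', ← hψ', e.le_iff_le, ptH_le_ptH]
  have hA (h : H) : e (aux DG DH W f .A h DH.midZero) = aux DG DH W g .A (b * h) DH.midZero := by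
    have hh := (isPtA_apply e).2 (isPtA_iff.2 ⟨h, rfl⟩)
    rw [hs, isPtA_iff] at hh
    obtain ⟨k, hk⟩ := hh
    -- The image under `e` of the common lower bound of `A_(h,0)` and `(h,0)` lies below `A_(k,0)`
    -- and `(b * h,0)` but not below `*`, so `k = b * h`.
    obtain ⟨q, h1, h2, h3⟩ := (exists_le_A_le_ptH_iff (DG := DG) (DH := DH) (W := W) (f := f)
      (h := h)).2 rfl
    rw [hk, (exists_le_A_le_ptH_iff (DG := DG) (DH := DH) (W := W) (f := g) (h := b * h)
      (k := k)).1
      ⟨e q, hk ▸ e.le_iff_le.2 h1, ?_, hs ▸ fun h => h3 (e.le_iff_le.1 h)⟩]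
    rw [← hb, ← hψ']
    exact e.le_iff_le.2 h2
  have key (x : G) : g (a * x) = b * f x := by
    rw [← ptG_zero_le_A_iff (DG := DG) (DH := DH) (W := W), ← ha, ← hφ', ← hA, e.le_iff_le,
      ptG_zero_le_A_iff]
  have hab : g a = b := by simpa using key 1
  ext x
  have := key x
  rw [map_mul, hab] at this
  exact (mul_left_cancel this).symm

omit [Nontrivial G] [Nontrivial H] in
-- The smallest open neighbourhood of `q` is `Set.Iic q`.
lemma specializes_iff_le {p q : Xf DG DH W f} : p ⤳ q ↔ p ≤ q := by
  rw [specializes_iff_forall_open]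
  constructor
  · intro h
    exact h (Set.Iic q) (isLowerSet_Iic q) Set.self_mem_Iic
  · intro h s hs hq
    exact isOpen_iff.1 hs h hq

end Xf

end Realization

theorem mainTheorem8 {G : Type u} {H : Type v} [Group G] [Group H]
    (DG : Realization.GenSet G) (DH : Realization.GenSet H)
    (W : H → Type w) [∀ h, LinearOrder (W h)] [∀ h, WellFoundedLT (W h)] [∀ h, Nonempty (W h)]
    (hW : ∀ h t : H, Nonempty (W h ≃o W t) ↔ h = t) (f g : G →* H) :
    f = g ↔ Nonempty (Realization.Xf DG DH W f ≃ₜ Realization.Xf DG DH W g) := by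
  constructor
  · rintro rfl
    exact ⟨Homeomorph.refl _⟩
  · rintro ⟨e⟩
    rcases subsingleton_or_nontrivial H with _ | _
    · ext x
      exact Subsingleton.elim _ _
    rcases subsingleton_or_nontrivial G with _ | _
    · ext x
      rw [Subsingleton.elim x 1, map_one, map_one]
    exact Realization.Xf.eq_of_orderIso ⟨e.toEquiv, fun {p q} => by
      rw [← Realization.Xf.specializes_iff_le, ← Realization.Xf.specializes_iff_le]
      exact e.isInducing.specializes_iff⟩
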